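/- Definitions. Let $Y$ be a metric space, $X\subset Y$ a subset with the induced metric, $E$ a real Banach space and $f\colon X\to E$ a Lipschitz map with Lipschitz constant $\mathrm{Lip}(f)=\inf\{L\ge 0: f \text{ is } L\text{-Lipschitz}\}$. Let $e(X,Y,E,f)$ be the infimum of those $K\ge 0$ for which $f$ has a $K\,\mathrm{Lip}(f)$-Lipschitz extension $\bar f\colon Y\to E$, let $\nu(X,Y)=\sup\{e(X,Y,E,f)\}$ over all real Banach spaces $E$ and all Lipschitz maps $f\colon X\to E$, and let the absolute extendability constant of a metric space $X$ be $\mathrm{ae}(X)=\sup_Y \nu(X,Y)$, the supremum over all metric spaces $Y$ containing $X$ isometrically. For a metric space $X$ with base point $p\in X$, let $\mathrm{Lip}_0(X)$ be the space of Lipschitz functions $f\colon X\to\mathbb R$ with $f(p)=0$, normed by $\sup_{x\ne x'}|f(x)-f(x')|/d(x,x')$, and let the Lipschitz-free space $\mathcal F(X)$ be the closure of $\mathrm{span}\{\delta(x):x\in X\}$ in the dual space $\mathrm{Lip}_0(X)^*$, where $\delta(x)(f)=f(x)$. If $\iota\colon X\to Y$ is an isometric embedding and $Y$ has the base point $\iota(p)$,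 there is a unique linear isometric embedding $\hat\iota\colon\mathcal F(X)\to\mathcal F(Y)$ with $\hat\iota(\delta(x))=\delta(\iota(x))$ for all $x\in X$; through it $\mathcal F(X)$, equivalently $\mathcal F(\iota(X))$, is regarded as a subspace of $\mathcal F(Y)$. For a subspace $E$ of a Banach space $F$, the relative projection constant $\lambda(E,F)$ is the infimum of $\|P\|$ over all bounded linear projections $P$ of $F$ onto $E$. All these constants take values in $[0,\infty]$, with $\inf\varnothing=\infty$. Theorem. Let $X$ be a non-empty finite metric space and let $p\in X$ be any base point. Then $$\mathrm{ae}(X)=\sup_{Y}\lambda\bigl(\mathcal F(X),\mathcal F(Y)\bigr),$$ where the supremum is taken over all finite metric spaces $Y$ containing $X$ isometrically. Moreover, $$\mathrm{ae}(X)=\lambda\bigl(\mathcal F(\iota(X)),\mathcal F(c_0)\bigr)$$ for every isometric embedding $\iota\colon X\to c_0$, where $c_0$ is the space of real null sequences with the supremum norm and $\mathcal F(\iota(X))$, $\mathcal F(c_0)$ are formed with the base point $\iota(p)$. -/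

import Mathlib

open scoped NNReal ENNReal ZeroAtInfty

universe u v w

noncomputable section

namespace LipExt

/-! ### Nonlinear Lipschitz extension constants

All constants take values in `[0, ∞]`, so that suprema are genuine and an infimum over the empty
set is `∞`. -/

/-- The Lipschitz constant `Lip(f) = inf {L ≥ 0 : f is L-Lipschitz}` (used for Lipschitz `f`). -/
def lipConst {X : Type*} {E : Type*} [MetricSpace X] [NormedAddCommGroup E] (f : X → E) : ℝ≥0 :=
  sInf {L : ℝ≥0 | LipschitzWith L f}

/-- `e(S, Y, E, f)`: the infimum of those `K ≥ 0` such that `f : S → E` extends to a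
`K * Lip(f)`-Lipschitz map `Y → E`. -/
def extModulus {Y : Type*} {E : Type*} [MetricSpace Y] [NormedAddCommGroup E]
    (S : Set Y) (f : S → E) : ℝ≥0∞ :=
  ⨅ (K : ℝ≥0) (_ : ∃ g : Y → E, LipschitzWith (K * lipConst f) g ∧ ∀ x : S, g x = f x), (K : ℝ≥0∞)

/-- `ν(S, Y)`: the supremum of `e(S, Y, E, f)` over all real Banach spaces `E` and all Lipschitz
maps `f : S → E`. -/
def traceConst {Y : Type v} [MetricSpace Y] (S : Set Y) : ℝ≥0∞ :=
  ⨆ (E : Type w) (_ : NormedAddCommGroup E) (_ : NormedSpace ℝ E) (_ : CompleteSpace E)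
    (f : S → E) (_ : ∃ L : ℝ≥0, LipschitzWith L f), extModulus S f

/-- The absolute extendability constant `ae(X)`: the supremum of `ν(X, Y)` over all metric spaces
`Y` containing an isometric copy of `X`. -/
def absExt (X : Type u) [MetricSpace X] : ℝ≥0∞ :=
  ⨆ (Y : Type v) (_ : MetricSpace Y) (ι : X → Y) (_ : Isometry ι),
    traceConst.{v, w} (Set.range ι)

/-! ### The Banach space `Lip₀(X)` -/

/-- The vector space of real Lipschitz functions on `X` that vanish at the base point `p`. -/
def lipSubmodule (X : Type*) [MetricSpace X] (p : X) : Submodule ℝ (X → ℝ) where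
  carrier := {f | f p = 0 ∧ ∃ K : ℝ≥0, LipschitzWith K f}
  add_mem' := by
    rintro f g ⟨hf, K, hK⟩ ⟨hg, L, hL⟩
    exact ⟨by simp [hf, hg], K + L, hK.add hL⟩
  zero_mem' := ⟨rfl, 0, LipschitzWith.const 0⟩
  smul_mem' := by
    rintro c f ⟨hf, K, hK⟩
    refine ⟨by simp [hf], ‖c‖₊ * K, LipschitzWith.of_dist_le_mul fun x y => ?_⟩
    have h := hK.dist_le_mul x y
    simp only [Pi.smul_apply, dist_smul₀, NNReal.coe_mul, coe_nnnorm]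
    rw [mul_assoc]
    exact mul_le_mul_of_nonneg_left h (norm_nonneg c)

/-- `Lip₀(X)` for the pointed metric space `(X, p)`. -/
def Lip0 (X : Type*) [MetricSpace X] (p : X) : Type _ := lipSubmodule X p

namespace Lip0

variable {X : Type*} [MetricSpace X] {p : X}

instance : AddCommGroup (Lip0 X p) := inferInstanceAs (AddCommGroup (lipSubmodule X p))

instance : Module ℝ (Lip0 X p) := inferInstanceAs (Module ℝ (lipSubmodule X p))

instance : CoeFun (Lip0 X p) (fun _ => X → ℝ) := ⟨fun f => f.1⟩

theorem add_apply (f g : Lip0 X p) (x : X) : (f + g) x = f x + g x := rfl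

theorem smul_apply (c : ℝ) (f : Lip0 X p) (x : X) : (c • f) x = c * f x := rfl

theorem apply_base (f : Lip0 X p) : f p = 0 := f.2.1

/-- `|f|_Lip = sup_{x ≠ y} |f x - f y| / d(x, y)`. The diagonal terms are `0 / 0 = 0` and do not
change the supremum of nonnegative numbers (which is `0` on a one-point space). -/
instance : Norm (Lip0 X p) := ⟨fun f => ⨆ q : X × X, |f q.1 - f q.2| / dist q.1 q.2⟩

theorem norm_def (f : Lip0 X p) : ‖f‖ = ⨆ q : X × X, |f q.1 - f q.2| / dist q.1 q.2 := rfl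

theorem bddAbove (f : Lip0 X p) :
    BddAbove (Set.range fun q : X × X => |f q.1 - f q.2| / dist q.1 q.2) := by
  obtain ⟨K, hK⟩ := f.2.2
  refine ⟨K, ?_⟩
  rintro _ ⟨q, rfl⟩
  have h := hK.dist_le_mul q.1 q.2
  rw [Real.dist_eq] at h
  exact div_le_of_le_mul₀ dist_nonneg K.2 h

theorem abs_sub_le (f : Lip0 X p) (x y : X) : |f x - f y| ≤ ‖f‖ * dist x y := by
  rcases eq_or_ne x y with rfl | hxy
  · simp
  · rw [← div_le_iff₀ (dist_pos.2 hxy)]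
    exact le_ciSup (bddAbove f) (x, y)

theorem norm_le (f : Lip0 X p) {C : ℝ} (hC : 0 ≤ C) (h : ∀ x y, |f x - f y| ≤ C * dist x y) :
    ‖f‖ ≤ C :=
  Real.iSup_le (fun q => div_le_of_le_mul₀ dist_nonneg hC (h q.1 q.2)) hC

theorem norm_nonneg' (f : Lip0 X p) : 0 ≤ ‖f‖ :=
  Real.iSup_nonneg fun _ => div_nonneg (abs_nonneg _) dist_nonneg

theorem core : NormedSpace.Core ℝ (Lip0 X p) where
  norm_nonneg := norm_nonneg'
  norm_smul c f := by
    simp only [norm_def, smul_apply, ← mul_sub, abs_mul, mul_div_assoc, Real.norm_eq_abs]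
    rw [Real.mul_iSup_of_nonneg (abs_nonneg c)]
  norm_triangle f g := by
    refine norm_le _ (add_nonneg (norm_nonneg' f) (norm_nonneg' g)) fun x y => ?_
    have h1 := abs_sub_le f x y
    have h2 := abs_sub_le g x y
    have h3 := abs_add_le (f x - f y) (g x - g y)
    rw [add_apply, add_apply, add_mul, add_sub_add_comm]
    linarith
  norm_eq_zero_iff f := by
    constructor
    · intro h
      refine Subtype.ext (funext fun x => ?_)
      have h1 := abs_sub_le f x p
      rw [h, zero_mul, apply_base, sub_zero] at h1
      exact abs_nonpos_iff.1 h1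
    · rintro rfl
      refine le_antisymm (norm_le _ le_rfl fun x y => ?_) (norm_nonneg' _)
      have h0 : ∀ z, (0 : Lip0 X p) z = 0 := fun _ => rfl
      simp [h0]

instance : NormedAddCommGroup (Lip0 X p) := NormedAddCommGroup.ofCore core

instance : NormedSpace ℝ (Lip0 X p) := NormedSpace.ofCore core

/-- Restriction `f ↦ f ∘ ι` along a base-point preserving isometric embedding. -/
def restrict {Y : Type*} [MetricSpace Y] (p : X) (ι : X → Y) (hι : Isometry ι) :
    Lip0 Y (ι p) →L[ℝ] Lip0 X p :=
  LinearMap.mkContinuous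
    { toFun := fun f => ⟨fun x => f (ι x), f.2.1, by
        obtain ⟨K, hK⟩ := f.2.2
        exact ⟨K * 1, hK.comp hι.lipschitz⟩⟩
      map_add' := fun _ _ => rfl
      map_smul' := fun _ _ => rfl } 1 (fun f => by
        rw [one_mul]
        refine norm_le _ (norm_nonneg f) fun x y => ?_
        rw [← hι.dist_eq]
        exact abs_sub_le f (ι x) (ι y))

end Lip0

/-! ### Lipschitz-free spaces -/

/-- The evaluation functional `δ(x) : Lip₀(X) → ℝ`. -/
def delta {X : Type*} [MetricSpace X] (p : X) (x : X) : StrongDual ℝ (Lip0 X p) :=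
  LinearMap.mkContinuous
    { toFun := fun f => f x
      map_add' := fun _ _ => rfl
      map_smul' := fun _ _ => rfl } (dist x p) (fun f => by
        have h := Lip0.abs_sub_le f x p
        rw [Lip0.apply_base, sub_zero] at h
        rw [mul_comm] at h
        exact h)

/-- The Lipschitz-free space `𝓕(X)` of the pointed metric space `(X, p)`: the closure of
`span {δ(x) : x ∈ X}` in `Lip₀(X)*`. -/
def freeSpace (X : Type*) [MetricSpace X] (p : X) : Submodule ℝ (StrongDual ℝ (Lip0 X p)) :=
  (Submodule.span ℝ (Set.range (delta p))).topologicalClosure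

/-- The adjoint `Lip₀(X)* → Lip₀(Y)*` of the restriction map along `ι`. -/
def dualMap {X Y : Type*} [MetricSpace X] [MetricSpace Y] (p : X) (ι : X → Y) (hι : Isometry ι) :
    StrongDual ℝ (Lip0 X p) →L[ℝ] StrongDual ℝ (Lip0 Y (ι p)) :=
  (Lip0.restrict p ι hι).precomp ℝ

theorem dualMap_delta {X Y : Type*} [MetricSpace X] [MetricSpace Y] (p : X) (ι : X → Y)
    (hι : Isometry ι) (x : X) : dualMap p ι hι (delta p x) = delta (ι p) (ι x) := rfl

theorem dualMap_mem {X Y : Type*} [MetricSpace X] [MetricSpace Y] (p : X) (ι : X → Y)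
    (hι : Isometry ι) (φ : freeSpace X p) :
    dualMap p ι hι (φ : StrongDual ℝ (Lip0 X p)) ∈ freeSpace Y (ι p) := by
  have h : freeSpace X p ≤ (freeSpace Y (ι p)).comap (dualMap p ι hι).toLinearMap := by
    refine Submodule.topologicalClosure_minimal _ ?_ ?_
    · rw [Submodule.span_le]
      rintro _ ⟨x, rfl⟩
      exact Submodule.le_topologicalClosure _ (Submodule.subset_span ⟨ι x, rfl⟩)
    · exact (Submodule.isClosed_topologicalClosure _).preimage (dualMap p ι hι).continuous
  exact h φ.2

/-- The canonical linear embedding `ι̂ : 𝓕(X) → 𝓕(Y)` induced by an isometric embedding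
`ι : (X, p) → (Y, ι p)`; it is determined by `ι̂ (δ(x)) = δ(ι x)`. -/
def freeMap {X Y : Type*} [MetricSpace X] [MetricSpace Y] (p : X) (ι : X → Y) (hι : Isometry ι) :
    freeSpace X p →L[ℝ] freeSpace Y (ι p) :=
  ((dualMap p ι hι).comp (freeSpace X p).subtypeL).codRestrict _ (dualMap_mem p ι hι)

/-! ### Relative projection constants -/

/-- `λ(E, F)`: the infimum of the norms of all bounded linear projections of `F` onto its
subspace `E`. -/
def projConst {F : Type*} [NormedAddCommGroup F] [NormedSpace ℝ F] (E : Submodule ℝ F) : ℝ≥0∞ :=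
  ⨅ (P : F →L[ℝ] E) (_ : ∀ x : E, P x = x), ‖P‖ₑ

/-- `λ(𝓕(X), 𝓕(Y))`, where `X` is viewed inside `Y` by the isometric embedding `ι`, the base
points are `p ∈ X` and `ι p ∈ Y`, and `𝓕(X)` is identified with the subspace `ι̂(𝓕(X))` of
`𝓕(Y)`. -/
def freeProjConst {X Y : Type*} [MetricSpace X] [MetricSpace Y] (p : X) (ι : X → Y)
    (hι : Isometry ι) : ℝ≥0∞ :=
  projConst (F := freeSpace Y (ι p)) (LinearMap.range (freeMap p ι hι).toLinearMap)

end LipExt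

end

/-! The map `δ : X → 𝓕(X)` is the universal Lipschitz map on `X`: a Lipschitz map into a Banach space
that vanishes at the base point factors through `δ` by a linear map of the same norm. Hence
extending Lipschitz maps from `X` to `Y` amounts to extending `δ` to a map `Y → 𝓕(X)`, and
linearizing that extension over `Y` turns it into a left inverse of `𝓕(X) → 𝓕(Y)`. So
`ν(X, Y) = λ(𝓕(X), 𝓕(Y))` for all `X ⊆ Y`.

For finite `X` the space `𝓕(X)` is proper, and extensions of `δ` to the finite subspaces of `Y` with
a common Lipschitz constant have a limit on `Y`. For compact `X ⊆ c₀` the inclusion extends to a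
nonexpansive map `Y → c₀` on every `Y ⊇ X`, so `c₀` is the worst case for extending from `X`. -/

namespace LipExt

open Filter Function Set TopologicalSpace

-- At the default depth the norm of `freeSpace X p →L[ℝ] E` is not found.
set_option maxSynthPendingDepth 3

section LipschitzExtension

theorem lipschitzWith_lipConst {X E : Type*} [MetricSpace X] [NormedAddCommGroup E] {f : X → E}
    (hf : ∃ L : ℝ≥0, LipschitzWith L f) : LipschitzWith (lipConst f) f := by
  refine LipschitzWith.of_dist_le_mul fun x y => ?_
  rcases eq_or_ne x y with rfl | hxy
  · simp
  · have hd : 0 < dist x y := dist_pos.2 hxy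
    rw [← div_le_iff₀ hd]
    refine Real.toNNReal_le_iff_le_coe.1 (le_csInf hf fun L hL => ?_)
    exact Real.toNNReal_le_iff_le_coe.2 ((div_le_iff₀ hd).2 (hL.dist_le_mul x y))

theorem lipConst_le {X E : Type*} [MetricSpace X] [NormedAddCommGroup E] {f : X → E} {L : ℝ≥0}
    (hf : LipschitzWith L f) : lipConst f ≤ L :=
  csInf_le (OrderBot.bddBelow _) hf

theorem lipschitzOnWith_extend {X Y Z : Type*} [EMetricSpace X] [PseudoEMetricSpace Y]
    [PseudoEMetricSpace Z] {ι : X → Y} (hι : Isometry ι) {K : ℝ≥0} {f : X → Z}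
    (hf : LipschitzWith K f) (g : Y → Z) : LipschitzOnWith K (extend ι f g) (range ι) := by
  rintro _ ⟨x, rfl⟩ _ ⟨y, rfl⟩
  rw [hι.injective.extend_apply, hι.injective.extend_apply, hι.edist_eq]
  exact hf x y

theorem exists_lipschitzWith_real_extension {X Y : Type*} [MetricSpace X] [PseudoMetricSpace Y]
    {ι : X → Y} (hι : Isometry ι) {K : ℝ≥0} {f : X → ℝ} (hf : LipschitzWith K f) :
    ∃ g : Y → ℝ, LipschitzWith K g ∧ ∀ x, g (ι x) = f x := by
  obtain ⟨g, hg, hfg⟩ := (lipschitzOnWith_extend hι hf 0).extend_real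
  exact ⟨g, hg, fun x => by rw [← hfg ⟨x, rfl⟩, hι.injective.extend_apply]⟩

/-- A common subsequential limit, along an ultrafilter, of maps that are good on finite sets. -/
theorem exists_lipschitzWith_extension_of_finset {X Y Z : Type*} [Nonempty X] [PseudoMetricSpace Y]
    [MetricSpace Z] [ProperSpace Z] {K : ℝ≥0} {ι : X → Y} {f : X → Z}
    (h : ∀ F : Finset Y, ∃ g : Y → Z, LipschitzOnWith K g F ∧ ∀ x, ι x ∈ F → g (ι x) = f x) :
    ∃ g : Y → Z, LipschitzWith K g ∧ ∀ x, g (ι x) = f x := by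
  choose g hg hgf using h
  let U : Ultrafilter (Finset Y) := Ultrafilter.of atTop
  have eventually_mem (y : Y) : ∀ᶠ F in (U : Filter (Finset Y)), y ∈ F :=
    Ultrafilter.of_le _ ((eventually_ge_atTop {y}).mono fun F => Finset.singleton_subset_iff.1)
  obtain ⟨x₀⟩ := ‹Nonempty X›
  have exists_limit (y : Y) : ∃ z, Tendsto (g · y) U (nhds z) := by
    have bounded : ∀ᶠ F in (U : Filter (Finset Y)),
        g F y ∈ Metric.closedBall (f x₀) (K * dist y (ι x₀)) := by
      filter_upwards [eventually_mem y, eventually_mem (ι x₀)] with F hy hx₀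
      rw [← hgf F x₀ hx₀]
      exact (hg F).dist_le_mul y hy _ hx₀
    obtain ⟨z, -, hz⟩ := (isCompact_closedBall _ _).ultrafilter_le_nhds (U.map (g · y))
      (le_principal_iff.2 bounded)
    exact ⟨z, hz⟩
  choose r hr using exists_limit
  refine ⟨r, LipschitzWith.of_dist_le_mul fun y z => ?_, fun x => ?_⟩
  · refine le_of_tendsto ((hr y).dist (hr z)) ?_
    filter_upwards [eventually_mem y, eventually_mem z] with F hy hz
    exact (hg F).dist_le_mul y hy z hz
  · refine tendsto_nhds_unique (hr (ι x)) (tendsto_const_nhds.congr' ?_)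
    filter_upwards [eventually_mem (ι x)] with F hx using (hgf F x hx).symm

end LipschitzExtension

section LipExtConst

/-- The infimum of the Lipschitz constants of the extensions of `f : X → Z` along `ι : X → Y`,
that is, of the maps `g : Y → Z` with `g ∘ ι = f`; it is `∞` if no such `g` is Lipschitz. -/
noncomputable def lipExtConst {X Y Z : Type*} [PseudoEMetricSpace Y] [PseudoEMetricSpace Z]
    (ι : X → Y) (f : X → Z) : ℝ≥0∞ :=
  ⨅ (K : ℝ≥0) (_ : ∃ g : Y → Z, LipschitzWith K g ∧ ∀ x, g (ι x) = f x), (K : ℝ≥0∞)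

variable {X Y Z : Type*} {ι : X → Y} {f : X → Z}

theorem lipExtConst_le [PseudoEMetricSpace Y] [PseudoEMetricSpace Z] {K : ℝ≥0} {g : Y → Z}
    (hg : LipschitzWith K g) (hgf : ∀ x, g (ι x) = f x) : lipExtConst ι f ≤ K :=
  iInf₂_le K ⟨g, hg, hgf⟩

theorem lipExtConst_comp_le [PseudoEMetricSpace Y] [PseudoEMetricSpace Z] {W : Type*}
    [PseudoEMetricSpace W] {h : Y → W} (hh : LipschitzWith 1 h) :
    lipExtConst ι f ≤ lipExtConst (h ∘ ι) f := by
  refine le_iInf₂ fun K ⟨g, hg, hgf⟩ => lipExtConst_le (g := g ∘ h) ?_ hgf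
  simpa only [mul_one] using hg.comp hh

theorem lipExtConst_le_of_finite [Finite X] [Nonempty X] [MetricSpace Y] [MetricSpace Z]
    [ProperSpace Z] {a : ℝ≥0∞}
    (h : ∀ S : Set Y, S.Finite → ∀ hS : ∀ x, ι x ∈ S, lipExtConst (codRestrict ι S hS) f ≤ a) :
    lipExtConst ι f ≤ a := by
  refine le_of_forall_gt fun b hab => ?_
  obtain ⟨K, haK, hKb⟩ := ENNReal.lt_iff_exists_nnreal_btwn.1 hab
  refine (?_ : lipExtConst ι f ≤ K).trans_lt hKb
  obtain ⟨g, hg, hgf⟩ : ∃ g : Y → Z, LipschitzWith K g ∧ ∀ x, g (ι x) = f x := by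
    refine exists_lipschitzWith_extension_of_finset fun F => ?_
    let S : Set Y := F ∪ range ι
    have hS : ∀ x, ι x ∈ S := fun x => Or.inr ⟨x, rfl⟩
    obtain ⟨K', ⟨g, hg, hgf⟩, hK'⟩ : ∃ K' : ℝ≥0, ∃ (_ : ∃ g : S → Z, LipschitzWith K' g ∧
        ∀ x, g (codRestrict ι S hS x) = f x), (K' : ℝ≥0∞) < K := by
      simpa only [lipExtConst, iInf_lt_iff] using
        (h S (F.finite_toSet.union (finite_range ι)) hS).trans_lt haK
    have hgK : LipschitzWith K g := hg.weaken (ENNReal.coe_lt_coe.1 hK').le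
    refine ⟨extend Subtype.val g fun _ => f (Classical.arbitrary X), ?_, fun x _ => ?_⟩
    · refine (lipschitzOnWith_extend isometry_subtype_coe hgK _).mono ?_
      rw [Subtype.range_coe]
      exact subset_union_left
    · rw [← hgf x]
      exact Subtype.val_injective.extend_apply g _ (codRestrict ι S hS x)
  exact lipExtConst_le hg hgf

end LipExtConst

section ZeroAtInfty

variable {I : Type*} [TopologicalSpace I]

theorem lipschitzOnWith_zeroAtInfty_iff {Y : Type*} [PseudoMetricSpace Y] {s : Set Y} {K : ℝ≥0}
    {f : Y → C₀(I, ℝ)} :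
    LipschitzOnWith K f s ↔ ∀ i, LipschitzOnWith K (fun y => f y i) s := by
  simp only [lipschitzOnWith_iff_dist_le_mul, ← ZeroAtInftyContinuousMap.dist_toBCF_eq_dist]
  refine ⟨fun h i x hx y hy => ?_, fun h x hx y hy => ?_⟩
  · exact (BoundedContinuousFunction.dist_coe_le_dist i).trans (h x hx y hy)
  · exact (BoundedContinuousFunction.dist_le (by positivity)).2 fun i => h i x hx y hy

variable [DiscreteTopology I]

theorem exists_zeroAtInfty_abs_le_of_isCompact {C : Set C₀(I, ℝ)} (hC : IsCompact C) :
    ∃ B : C₀(I, ℝ), ∀ u ∈ C, ∀ i, |u i| ≤ B i := by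
  have : CompactSpace C := isCompact_iff_compactSpace.1 hC
  have coord_lipschitz (i : I) : LipschitzWith 1 fun u : C => (u : C₀(I, ℝ)) i :=
    lipschitzOnWith_univ.1 <|
      lipschitzOnWith_zeroAtInfty_iff.1 (LipschitzWith.subtype_val C).lipschitzOnWith i
  let coord (i : I) : C(C, ℝ) := ⟨fun u => (u : C₀(I, ℝ)) i, (coord_lipschitz i).continuous⟩
  -- On a compact space an equicontinuous family converges uniformly once it converges pointwise.
  have coord_tendsto : Tendsto coord (cocompact I) (nhds 0) := by
    rw [ContinuousMap.tendsto_iff_tendstoUniformly]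
    have equicontinuous : Equicontinuous fun (i : I) (u : C) => (u : C₀(I, ℝ)) i :=
      (LipschitzWith.uniformEquicontinuous _ 1 coord_lipschitz).equicontinuous
    refine UniformFun.tendsto_iff_tendstoUniformly.1
      ((equicontinuous.tendsto_uniformFun_iff_pi _ 0).2 (tendsto_pi_nhds.2 fun u => ?_))
    exact (u : C₀(I, ℝ)).zero_at_infty'
  refine ⟨⟨⟨fun i => ‖coord i‖, continuous_of_discreteTopology⟩, ?_⟩, fun u hu i => ?_⟩
  · simpa only [norm_zero] using coord_tendsto.norm
  · exact (coord i).norm_coe_le_norm ⟨u, hu⟩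

theorem exists_lipschitzWith_zeroAtInfty_extension {Y : Type*} [PseudoMetricSpace Y] {s : Set Y}
    (hs : IsCompact s) {K : ℝ≥0} {f : Y → C₀(I, ℝ)} (hf : LipschitzOnWith K f s) :
    ∃ g : Y → C₀(I, ℝ), LipschitzWith K g ∧ EqOn f g s := by
  obtain ⟨B, hB⟩ :=
    exists_zeroAtInfty_abs_le_of_isCompact (hs.image_of_continuousOn hf.continuousOn)
  choose g hg hfg using fun i => (lipschitzOnWith_zeroAtInfty_iff.1 hf i).extend_real
  -- Truncating the coordinatewise extensions at `± |B|` makes them null families.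
  let c (i : I) (y : Y) : ℝ := max (-|B i|) (min |B i| (g i y))
  have abs_c_le (i : I) (y : Y) : |c i y| ≤ |B i| :=
    abs_le.2 ⟨le_max_left _ _, max_le (neg_le_self (abs_nonneg _)) (min_le_left _ _)⟩
  have c_tendsto (y : Y) : Tendsto (c · y) (cocompact I) (nhds 0) :=
    squeeze_zero_norm (abs_c_le · y) (by simpa using (zero_at_infty B).abs)
  refine ⟨fun y => ⟨⟨fun i => c i y, continuous_of_discreteTopology⟩, c_tendsto y⟩, ?_,
    fun y hy => ZeroAtInftyContinuousMap.ext fun i => ?_⟩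
  · rw [← lipschitzOnWith_univ, lipschitzOnWith_zeroAtInfty_iff]
    exact fun i => (((hg i).const_min _).const_max _).lipschitzOnWith
  · have hfB := abs_le.1 ((hB (f y) ⟨y, hy, rfl⟩ i).trans (le_abs_self _))
    change f y i = max (-|B i|) (min |B i| (g i y))
    rw [← hfg i hy, min_eq_right hfB.2, max_eq_right hfB.1]

end ZeroAtInfty

section FreeSpace

variable {X : Type*} [MetricSpace X] {p : X} {E : Type*} [NormedAddCommGroup E] [NormedSpace ℝ E]

theorem Lip0.lipschitzWith (f : Lip0 X p) : LipschitzWith ‖f‖₊ (f : X → ℝ) :=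
  LipschitzWith.of_dist_le_mul fun x y => Lip0.abs_sub_le f x y

/-- The linear map `ψ ↦ ψ ∘ f` from `E*` to `Lip₀(X)` given by a Lipschitz map `f : X → E` that
vanishes at the base point. -/
noncomputable def Lip0.compDual {L : ℝ≥0} (f : X → E) (hf : LipschitzWith L f) (hp : f p = 0) :
    StrongDual ℝ E →L[ℝ] Lip0 X p :=
  LinearMap.mkContinuous
    { toFun := fun ψ => ⟨ψ ∘ f, by simp [hp], ‖ψ‖₊ * L, ψ.lipschitz.comp hf⟩
      map_add' := fun _ _ => rfl
      map_smul' := fun _ _ => rfl } L fun ψ => by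
        refine Lip0.norm_le _ (by positivity) fun x y => ?_
        rw [mul_comm (L : ℝ)]
        exact (ψ.lipschitz.comp hf).dist_le_mul x y

theorem Lip0.norm_compDual_le {L : ℝ≥0} {f : X → E} (hf : LipschitzWith L f) (hp : f p = 0) :
    ‖Lip0.compDual f hf hp‖ ≤ L :=
  LinearMap.mkContinuous_norm_le _ L.2 _

theorem isClosed_freeSpace : IsClosed (freeSpace X p : Set (StrongDual ℝ (Lip0 X p))) :=
  Submodule.isClosed_topologicalClosure _

instance : CompleteSpace (freeSpace X p) := isClosed_freeSpace.completeSpace_coe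

theorem freeSpace_le {M : Submodule ℝ (StrongDual ℝ (Lip0 X p))}
    (hM : IsClosed (M : Set (StrongDual ℝ (Lip0 X p)))) (h : ∀ x, delta p x ∈ M) :
    freeSpace X p ≤ M :=
  Submodule.topologicalClosure_minimal _ (Submodule.span_le.2 (range_subset_iff.2 h)) hM

variable (p) in
/-- The canonical map `δ : X → 𝓕(X)`. -/
noncomputable def freeDelta (x : X) : freeSpace X p :=
  ⟨delta p x, Submodule.le_topologicalClosure _ (Submodule.subset_span ⟨x, rfl⟩)⟩

theorem freeDelta_base : freeDelta p p = 0 :=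
  Subtype.ext (ContinuousLinearMap.ext Lip0.apply_base)

theorem lipschitzWith_freeDelta : LipschitzWith 1 (freeDelta p) := by
  refine LipschitzWith.of_dist_le_mul fun x y => ?_
  rw [NNReal.coe_one, one_mul, Subtype.dist_eq, dist_eq_norm]
  refine ContinuousLinearMap.opNorm_le_bound _ dist_nonneg fun f => ?_
  rw [mul_comm]
  exact Lip0.abs_sub_le f x y

theorem freeSpace_hom_ext {S T : freeSpace X p →L[ℝ] E}
    (h : ∀ x, S (freeDelta p x) = T (freeDelta p x)) : S = T := by
  have hle : freeSpace X p ≤ (S.eqLocus T).map (freeSpace X p).subtype := by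
    refine freeSpace_le ?_ fun x => ⟨freeDelta p x, h x, rfl⟩
    exact isClosed_freeSpace.isClosedEmbedding_subtypeVal.isClosedMap _
      (isClosed_eq S.continuous T.continuous)
  refine ContinuousLinearMap.ext fun φ => ?_
  obtain ⟨_, mem_eqLocus, h_eq⟩ := hle φ.2
  exact Subtype.ext h_eq ▸ mem_eqLocus

/-- The linearization is `φ ↦ (ψ ↦ φ (ψ ∘ f))`, which a priori takes values in the bidual of `E`. -/
theorem exists_linearization [CompleteSpace E] {L : ℝ≥0} {f : X → E} (hf : LipschitzWith L f)
    (hp : f p = 0) :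
    ∃ T : freeSpace X p →L[ℝ] E, ‖T‖ ≤ L ∧ ∀ x, T (freeDelta p x) = f x := by
  let J := NormedSpace.inclusionInDoubleDualLi ℝ (E := E)
  let A : StrongDual ℝ (Lip0 X p) →L[ℝ] StrongDual ℝ (StrongDual ℝ E) :=
    (Lip0.compDual f hf hp).precomp ℝ
  have norm_A_le (φ : StrongDual ℝ (Lip0 X p)) : ‖A φ‖ ≤ L * ‖φ‖ := by
    rw [mul_comm]
    exact (φ.opNorm_comp_le _).trans (by gcongr; exact Lip0.norm_compDual_le hf hp)
  have A_mem (φ : freeSpace X p) : A φ ∈ LinearMap.range J.toLinearMap := by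
    refine (freeSpace_le (M := (LinearMap.range J.toLinearMap).comap A.toLinearMap) ?_ ?_) φ.2
    · exact J.isometry.isClosedEmbedding.isClosed_range.preimage A.continuous
    · exact fun x => ⟨f x, rfl⟩
  let T : freeSpace X p →L[ℝ] E := (J.equivRange.symm.toContinuousLinearEquiv : _ →L[ℝ] E).comp
    ((A.comp (freeSpace X p).subtypeL).codRestrict _ A_mem)
  have J_T (φ : freeSpace X p) : J (T φ) = A φ :=
    congrArg Subtype.val (J.equivRange.apply_symm_apply ⟨A φ, A_mem φ⟩)
  refine ⟨T, T.opNorm_le_bound L.2 fun φ => ?_, fun x => J.injective (J_T _)⟩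
  rw [← J.norm_map, J_T]
  exact norm_A_le φ

theorem exists_lipschitzWith_extension_of_freeDelta [CompleteSpace E] {Y : Type*}
    [PseudoEMetricSpace Y] {ι : X → Y} {K L : ℝ≥0} {r : Y → freeSpace X p} (hr : LipschitzWith K r)
    (hrι : ∀ x, r (ι x) = freeDelta p x) {f : X → E} (hf : LipschitzWith L f) :
    ∃ g : Y → E, LipschitzWith (L * K) g ∧ ∀ x, g (ι x) = f x := by
  obtain ⟨T, hT, hTf⟩ := exists_linearization (p := p) (f := fun x => f x - f p)
    (by simpa using hf.sub (LipschitzWith.const (f p))) (sub_self _)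
  refine ⟨fun y => T (r y) + f p, ?_, fun x => by simp only [hrι, hTf, sub_add_cancel]⟩
  simpa using ((T.lipschitz.weaken hT).comp hr).add (LipschitzWith.const (f p))

instance [Finite X] : FiniteDimensional ℝ (Lip0 X p) :=
  inferInstanceAs (FiniteDimensional ℝ (lipSubmodule X p))

instance [SeparableSpace X] : SeparableSpace (freeSpace X p) := by
  have h : IsSeparable (range (delta p)) :=
    isSeparable_range (continuous_subtype_val.comp lipschitzWith_freeDelta.continuous)
  exact h.span.closure.separableSpace

end FreeSpace

section ProjectionConstants

theorem projConst_range {G F : Type*} [NormedAddCommGroup G] [NormedSpace ℝ G]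
    [NormedAddCommGroup F] [NormedSpace ℝ F] (T : G →L[ℝ] F) (hT : ∀ x, ‖T x‖ = ‖x‖) :
    projConst (LinearMap.range T.toLinearMap) =
      ⨅ (S : F →L[ℝ] G) (_ : ∀ x, S (T x) = x), ‖S‖ₑ := by
  refine le_antisymm (le_iInf₂ fun S hS => ?_) (le_iInf₂ fun P hP => ?_)
  · let P : F →L[ℝ] LinearMap.range T.toLinearMap := (T.comp S).codRestrict _ fun y => ⟨S y, rfl⟩
    have hP : ∀ x : LinearMap.range T.toLinearMap, P x = x := by
      rintro ⟨_, x, rfl⟩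
      exact Subtype.ext (congrArg T (hS x))
    refine (iInf₂_le P hP).trans (enorm_le_iff_norm_le.2 ?_)
    refine ContinuousLinearMap.opNorm_le_bound _ (norm_nonneg S) fun y => ?_
    exact (hT (S y)).trans_le (S.le_opNorm y)
  · let e := (⟨T.toLinearMap, hT⟩ : G →ₗᵢ[ℝ] F).equivRange
    let S : F →L[ℝ] G := (e.symm.toContinuousLinearEquiv : _ →L[ℝ] G).comp P
    have hS : ∀ x, S (T x) = x := fun x => by
      have hPT : P (T x) = e x := hP ⟨T x, x, rfl⟩
      exact e.symm_apply_eq.2 hPT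
    refine (iInf₂_le S hS).trans (enorm_le_iff_norm_le.2 ?_)
    refine ContinuousLinearMap.opNorm_le_bound _ (norm_nonneg P) fun y => ?_
    exact (e.symm.norm_map (P y)).trans_le (P.le_opNorm y)

variable {X Y : Type*} [MetricSpace X] [MetricSpace Y] {p : X} {ι : X → Y}

theorem norm_freeMap (hι : Isometry ι) (φ : freeSpace X p) : ‖freeMap p ι hι φ‖ = ‖φ‖ := by
  refine le_antisymm ?_ (ContinuousLinearMap.opNorm_le_bound _ (norm_nonneg _) fun f => ?_)
  · refine (φ.1.opNorm_comp_le _).trans (mul_le_of_le_one_right (norm_nonneg _) ?_)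
    exact LinearMap.mkContinuous_norm_le _ zero_le_one _
  · obtain ⟨g, hg, hgf⟩ := exists_lipschitzWith_real_extension hι f.lipschitzWith
    let G : Lip0 Y (ι p) := ⟨g, by rw [hgf, Lip0.apply_base], _, hg⟩
    have norm_G_le : ‖G‖ ≤ ‖f‖ := Lip0.norm_le _ (norm_nonneg f) hg.dist_le_mul
    have restrict_G : Lip0.restrict p ι hι G = f := Subtype.ext (funext hgf)
    calc ‖φ.1 f‖ = ‖(freeMap p ι hι φ).1 G‖ := by rw [← restrict_G]; rfl
      _ ≤ ‖freeMap p ι hι φ‖ * ‖G‖ := ContinuousLinearMap.le_opNorm _ _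
      _ ≤ ‖freeMap p ι hι φ‖ * ‖f‖ := by gcongr

theorem freeProjConst_eq_lipExtConst (hι : Isometry ι) :
    freeProjConst p ι hι = lipExtConst ι (freeDelta p) := by
  refine (projConst_range _ (norm_freeMap hι)).trans (le_antisymm ?_ ?_)
  · refine le_iInf₂ fun K ⟨r, hr, hrι⟩ => ?_
    obtain ⟨S, hSK, hSr⟩ := exists_linearization hr ((hrι p).trans freeDelta_base)
    have left_inverse : S.comp (freeMap p ι hι) = .id ℝ _ :=
      freeSpace_hom_ext fun x => (hSr (ι x)).trans (hrι x)
    exact (iInf₂_le S fun φ => congrArg (· φ) left_inverse).trans (ENNReal.coe_le_coe.2 hSK)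
  · refine le_iInf₂ fun S hS => lipExtConst_le (K := ‖S‖₊) (g := S ∘ freeDelta (ι p)) ?_ ?_
    · simpa only [mul_one] using S.lipschitz.comp lipschitzWith_freeDelta
    · exact fun x => hS (freeDelta p x)

end ProjectionConstants

section AbsoluteExtendability

/-- The canonical isometry between a small normed space and its copy in a given universe. -/
noncomputable def shrinkLinearIsometryEquiv (E : Type*) [NormedAddCommGroup E] [NormedSpace ℝ E]
    [Small.{w} E] : Shrink.{w} E ≃ₗᵢ[ℝ] E where
  toLinearEquiv := Shrink.linearEquiv ℝ E
  norm_map' _ := rfl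

theorem small_of_separableSpace (X : Type*) [MetricSpace X] [SeparableSpace X] : Small.{w} X :=
  small_of_injective (kuratowskiEmbedding.isometry X).injective

variable {X : Type u} [MetricSpace X] {p : X}

theorem traceConst_range_eq_freeProjConst [Small.{w} (freeSpace X p)] {Y : Type v} [MetricSpace Y]
    {ι : X → Y} (hι : Isometry ι) :
    traceConst.{v, w} (range ι) = freeProjConst p ι hι := by
  rw [freeProjConst_eq_lipExtConst]
  refine le_antisymm (le_iInf₂ fun K ⟨r, hr, hrι⟩ => ?_) ?_
  · refine iSup_le fun E => iSup_le fun _ => iSup_le fun _ => iSup_le fun _ =>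
      iSup₂_le fun f hf => ?_
    have hfι : LipschitzWith (lipConst f) (f ∘ hι.isometryEquivOnRange) := by
      simpa only [mul_one] using
        (lipschitzWith_lipConst hf).comp hι.isometryEquivOnRange.isometry.lipschitz
    obtain ⟨g, hg, hgf⟩ := exists_lipschitzWith_extension_of_freeDelta hr hrι hfι
    exact iInf₂_le K ⟨g, mul_comm K _ ▸ hg, by rintro ⟨_, x, rfl⟩; exact hgf x⟩
  · let e := shrinkLinearIsometryEquiv.{w} (freeSpace X p)
    have : CompleteSpace (Shrink.{w} (freeSpace X p)) :=
      e.toIsometryEquiv.completeSpace_iff.2 inferInstance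
    let f : range ι → Shrink.{w} (freeSpace X p) :=
      e.symm ∘ freeDelta p ∘ hι.isometryEquivOnRange.symm
    have hf : LipschitzWith 1 f := by
      simpa only [mul_one] using e.symm.lipschitz.comp
        (lipschitzWith_freeDelta.comp hι.isometryEquivOnRange.symm.isometry.lipschitz)
    refine le_trans (le_iInf₂ fun K ⟨g, hg, hgf⟩ => ?_) <| le_iSup_of_le _ <| le_iSup_of_le _ <|
      le_iSup_of_le inferInstance <| le_iSup_of_le this <| le_iSup₂_of_le f ⟨1, hf⟩ le_rfl
    have hgK : LipschitzWith K g := hg.weaken (mul_le_of_le_one_right zero_le (lipConst_le hf))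
    have heg : LipschitzWith K (e ∘ g) := by simpa only [one_mul] using e.lipschitz.comp hgK
    refine lipExtConst_le heg fun x => ?_
    calc e (g (ι x)) = e (f (hι.isometryEquivOnRange x)) := congrArg e (hgf ⟨ι x, x, rfl⟩)
      _ = freeDelta p (hι.isometryEquivOnRange.symm (hι.isometryEquivOnRange x)) :=
          e.apply_symm_apply _
      _ = freeDelta p x := by rw [IsometryEquiv.symm_apply_apply]

theorem absExt_eq_iSup_freeProjConst [Small.{w} (freeSpace X p)] :
    absExt.{u, v, w} X = ⨆ (Y : Type v) (_ : MetricSpace Y) (ι : X → Y) (hι : Isometry ι),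
      freeProjConst p ι hι := by
  exact iSup_congr fun Y => iSup_congr fun _ => iSup_congr fun ι => iSup_congr fun hι =>
    traceConst_range_eq_freeProjConst hι

theorem freeProjConst_le_absExt [Small.{w} (freeSpace X p)] {Y : Type v} [MetricSpace Y]
    {ι : X → Y} (hι : Isometry ι) : freeProjConst p ι hι ≤ absExt.{u, v, w} X := by
  rw [absExt_eq_iSup_freeProjConst (p := p)]
  exact le_iSup_of_le Y <| le_iSup_of_le _ <| le_iSup₂_of_le ι hι le_rfl

theorem absExt_eq_iSup_finite [Finite X] :
    absExt.{u, v, w} X =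
      ⨆ (Y : Type v) (_ : MetricSpace Y) (_ : Finite Y) (ι : X → Y) (hι : Isometry ι),
        freeProjConst p ι hι := by
  have : Small.{w} (freeSpace X p) := small_of_separableSpace _
  refine le_antisymm ?_ ?_
  · rw [absExt_eq_iSup_freeProjConst (p := p)]
    refine iSup_le fun Y => iSup_le fun _ => iSup₂_le fun ι hι => ?_
    have : ProperSpace (freeSpace X p) := FiniteDimensional.proper ℝ _
    have : Nonempty X := ⟨p⟩
    rw [freeProjConst_eq_lipExtConst]
    refine lipExtConst_le_of_finite fun S hS hιS => ?_
    have hι' : Isometry (codRestrict ι S hιS) := fun x y => hι x y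
    rw [← freeProjConst_eq_lipExtConst hι']
    exact le_iSup_of_le S <| le_iSup_of_le _ <| le_iSup_of_le hS.to_subtype <|
      le_iSup₂_of_le _ hι' le_rfl
  · exact iSup_le fun Y => iSup_le fun _ => iSup_le fun _ => iSup₂_le fun ι hι =>
      freeProjConst_le_absExt hι

theorem absExt_eq_freeProjConst_zeroAtInfty [CompactSpace X] {I : Type*} [TopologicalSpace I]
    [DiscreteTopology I] [Small.{v} C₀(I, ℝ)] {ι : X → C₀(I, ℝ)} (hι : Isometry ι) :
    absExt.{u, v, w} X = freeProjConst p ι hι := by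
  have : Small.{w} (freeSpace X p) := small_of_separableSpace _
  refine le_antisymm ?_ ?_
  · rw [absExt_eq_iSup_freeProjConst (p := p)]
    refine iSup_le fun Y => iSup_le fun _ => iSup₂_le fun j hj => ?_
    obtain ⟨h, hh, hhj⟩ := exists_lipschitzWith_zeroAtInfty_extension
      (isCompact_range hj.continuous) (lipschitzOnWith_extend hj hι.lipschitz 0)
    have hι_eq : h ∘ j = ι := funext fun x => by
      rw [comp_apply, ← hhj ⟨x, rfl⟩, hj.injective.extend_apply]
    rw [freeProjConst_eq_lipExtConst, freeProjConst_eq_lipExtConst, ← hι_eq]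
    exact lipExtConst_comp_le hh
  · let e := (shrinkLinearIsometryEquiv.{v} C₀(I, ℝ)).symm
    refine le_trans ?_ (freeProjConst_le_absExt (p := p) (e.isometry.comp hι))
    rw [freeProjConst_eq_lipExtConst, freeProjConst_eq_lipExtConst]
    exact lipExtConst_comp_le e.lipschitz

end AbsoluteExtendability

end LipExt

theorem theorem1p4_general (X : Type u) [MetricSpace X] [CompactSpace X] (p : X) :
    (Finite X → LipExt.absExt.{u, v, w} X =
      ⨆ (Y : Type v) (_ : MetricSpace Y) (_ : Finite Y) (ι : X → Y) (hι : Isometry ι),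
        LipExt.freeProjConst p ι hι) ∧
    (∀ {I : Type*} [TopologicalSpace I] [DiscreteTopology I] [Small.{v} C₀(I, ℝ)]
      (ι : X → C₀(I, ℝ)) (hι : Isometry ι),
      LipExt.absExt.{u, v, w} X = LipExt.freeProjConst p ι hι) :=
  ⟨fun _ => LipExt.absExt_eq_iSup_finite, fun _ => LipExt.absExt_eq_freeProjConst_zeroAtInfty⟩

theorem theorem1p4 (X : Type u) [MetricSpace X] [Finite X] (p : X) :
    (LipExt.absExt.{u, v, w} X =
      ⨆ (Y : Type v) (_ : MetricSpace Y) (_ : Finite Y) (ι : X → Y) (hι : Isometry ι),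
        LipExt.freeProjConst p ι hι) ∧
    (∀ (ι : X → C₀(ℕ, ℝ)) (hι : Isometry ι),
      LipExt.absExt.{u, v, w} X = LipExt.freeProjConst p ι hι) :=
  have h := theorem1p4_general.{u, v, w} X p
  ⟨h.1 inferInstance, h.2⟩
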